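/- Let $(M,g)$ be a compact smooth Riemannian manifold without boundary, of dimension $n\ge 1$, with Ricci tensor $Ric$ and scalar curvature $R$. Suppose that $(M,g)$ is a generalized gradient Ricci-Yamabe soliton, that is, there are a smooth function $f:M\to\mathbb{R}$ (the potential function) and constants $\alpha,\beta,\lambda,\mu\in\mathbb{R}$ with $$\alpha\, Ric+\nabla^2 f+\Big(\lambda-\frac{\beta}{2}R\Big)g+\mu\, df\otimes df=0,$$ where $\nabla^2 f$ is the Hessian of $f$. The soliton is called shrinking, steady or expanding according as $\lambda<0$, $\lambda=0$ or $\lambda>0$. Assume that $R(p)=f(p)$ at every point $p\in M$ at which $f$ attains its maximum or its minimum over $M$, and that $n\beta>2\alpha$. Then the scalar curvature is negative, zero or positive according as the soliton is shrinking, steady or expanding; that is, at every point $p\in M$: $R(p)<0$ if and only if the soliton is shrinking, $R(p)=0$ if and only if it is steady, and $R(p)>0$ if and only if it is expanding. -/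

import Mathlib

open scoped Manifold ContDiff

noncomputable section

namespace RicciYamabe

/-! ### Local coordinate expressions

Throughout, `G : EuclideanSpace ℝ (Fin n) → Matrix (Fin n) (Fin n) ℝ` is the matrix `(g_ij)` of a
Riemannian metric in a coordinate system, as a function of the coordinates. -/

section Coordinates

variable {n : ℕ}

/-- The partial derivative `∂_i u` at the point `y`. -/
def pderiv (i : Fin n) (u : EuclideanSpace ℝ (Fin n) → ℝ) (y : EuclideanSpace ℝ (Fin n)) : ℝ :=
  fderiv ℝ u y (EuclideanSpace.single i 1)

/-- The Christoffel symbols of the Levi-Civita connection,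
`Γ^k_ij = ½ ∑ l, g^kl (∂_i g_jl + ∂_j g_il - ∂_l g_ij)`. -/
def christoffel (G : EuclideanSpace ℝ (Fin n) → Matrix (Fin n) (Fin n) ℝ) (k i j : Fin n)
    (y : EuclideanSpace ℝ (Fin n)) : ℝ :=
  (1 / 2) * ∑ l, (G y)⁻¹ k l *
    (pderiv i (fun z => G z j l) y + pderiv j (fun z => G z i l) y - pderiv l (fun z => G z i j) y)

/-- The components of the Ricci tensor,
`R_ij = ∑ k, (∂_k Γ^k_ij - ∂_j Γ^k_ik) + ∑ k l, (Γ^k_kl Γ^l_ij - Γ^k_jl Γ^l_ik)`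
(with this sign convention round spheres have positive Ricci curvature). -/
def ricciCoord (G : EuclideanSpace ℝ (Fin n) → Matrix (Fin n) (Fin n) ℝ) (i j : Fin n)
    (y : EuclideanSpace ℝ (Fin n)) : ℝ :=
  ∑ k, (pderiv k (christoffel G k i j) y - pderiv j (christoffel G k i k) y) +
    ∑ k, ∑ l, (christoffel G k k l y * christoffel G l i j y -
      christoffel G k j l y * christoffel G l i k y)

/-- The scalar curvature `R = ∑ i j, g^ij R_ij`. -/
def scalarCoord (G : EuclideanSpace ℝ (Fin n) → Matrix (Fin n) (Fin n) ℝ)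
    (y : EuclideanSpace ℝ (Fin n)) : ℝ :=
  ∑ i, ∑ j, (G y)⁻¹ i j * ricciCoord G i j y

/-- The components of the Hessian of a function, `∇_i ∇_j u = ∂_i ∂_j u - ∑ k, Γ^k_ij ∂_k u`. -/
def hessianCoord (G : EuclideanSpace ℝ (Fin n) → Matrix (Fin n) (Fin n) ℝ)
    (u : EuclideanSpace ℝ (Fin n) → ℝ) (i j : Fin n) (y : EuclideanSpace ℝ (Fin n)) : ℝ :=
  pderiv i (pderiv j u) y - ∑ k, christoffel G k i j y * pderiv k u y

end Coordinates

/-! ### Tensors on the manifold -/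

section Manifold

variable {n : ℕ} {M : Type*} [TopologicalSpace M] [ChartedSpace (EuclideanSpace ℝ (Fin n)) M]

/-- The coordinate vector field `∂_i` of the chart `e`, at the point with coordinates `y`. -/
def coordVector (e : OpenPartialHomeomorph M (EuclideanSpace ℝ (Fin n))) (i : Fin n)
    (y : EuclideanSpace ℝ (Fin n)) : TangentSpace (𝓡 n) (e.symm y) :=
  mfderiv (𝓡 n) (𝓡 n) e.symm y
    (show TangentSpace (𝓡 n) y from (EuclideanSpace.single i 1 : EuclideanSpace ℝ (Fin n)))

/-- The `i`-th component of the tangent vector `v` in the chart `e`, that is, `dx^i (v)`. -/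
def vectorCoord (e : OpenPartialHomeomorph M (EuclideanSpace ℝ (Fin n))) {p : M}
    (v : TangentSpace (𝓡 n) p) (i : Fin n) : ℝ :=
  (show EuclideanSpace ℝ (Fin n) from mfderiv (𝓡 n) (𝓡 n) e p v) i

/-- The differential `df` of a real-valued function, at the point `p`. -/
def differential (f : M → ℝ) (p : M) (v : TangentSpace (𝓡 n) p) : ℝ :=
  mfderiv (𝓡 n) 𝓘(ℝ) f p v

variable [IsManifold (𝓡 n) ∞ M]
  (g : Bundle.ContMDiffRiemannianMetric (𝓡 n) ∞ (EuclideanSpace ℝ (Fin n))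
    (fun p : M => TangentSpace (𝓡 n) p))

/-- The matrix `g_ij = g(∂_i, ∂_j)` of the metric in the chart `e`. -/
def metricCoord (e : OpenPartialHomeomorph M (EuclideanSpace ℝ (Fin n)))
    (y : EuclideanSpace ℝ (Fin n)) : Matrix (Fin n) (Fin n) ℝ :=
  Matrix.of fun i j => g.inner (e.symm y) (coordVector e i y) (coordVector e j y)

/-- The Ricci tensor `Ric(v, w)` at `p`. As the components transform as those of a tensor, it may
be computed in any chart around `p`; the preferred chart at `p` is used. -/
def ricci (p : M) (v w : TangentSpace (𝓡 n) p) : ℝ :=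
  let e := chartAt (EuclideanSpace ℝ (Fin n)) p
  ∑ i, ∑ j, ricciCoord (metricCoord g e) i j (e p) * vectorCoord e v i * vectorCoord e w j

/-- The scalar curvature `R` at `p`, computed in the preferred chart at `p`. -/
def scalarCurvature (p : M) : ℝ :=
  let e := chartAt (EuclideanSpace ℝ (Fin n)) p
  scalarCoord (metricCoord g e) (e p)

/-- The Hessian `∇²f(v, w)` at `p`, computed in the preferred chart at `p`. -/
def hessian (f : M → ℝ) (p : M) (v w : TangentSpace (𝓡 n) p) : ℝ :=
  let e := chartAt (EuclideanSpace ℝ (Fin n)) p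
  ∑ i, ∑ j, hessianCoord (metricCoord g e) (fun y => f (e.symm y)) i j (e p) *
    vectorCoord e v i * vectorCoord e w j

/-- `(M, g)` is a generalized gradient Ricci-Yamabe soliton with smooth potential function `f` and
constants `α β lam μ`: `α Ric + ∇²f + (lam - (β/2) R) g + μ df ⊗ df = 0`. -/
structure IsGeneralizedGradientRicciYamabeSoliton (f : M → ℝ) (α β lam μ : ℝ) : Prop where
  smooth : ContMDiff (𝓡 n) 𝓘(ℝ) ∞ f
  equation : ∀ (p : M) (v w : TangentSpace (𝓡 n) p),
    α * ricci g p v w + hessian g f p v w + (lam - β / 2 * scalarCurvature g p) * g.inner p v w +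
      μ * (differential f p v * differential f p w) = 0

end Manifold

/-- A soliton with constant `lam` is shrinking if `lam < 0`. -/
def IsShrinking (lam : ℝ) : Prop := lam < 0

/-- A soliton with constant `lam` is steady if `lam = 0`. -/
def IsSteady (lam : ℝ) : Prop := lam = 0

/-- A soliton with constant `lam` is expanding if `lam > 0`. -/
def IsExpanding (lam : ℝ) : Prop := 0 < lam

end RicciYamabe

end

/-! At a critical point of `f` the `df ⊗ df` term vanishes, and tracing the soliton equation with
`g⁻¹` gives `2 Δf = (nβ - 2α) R - 2nλ` (`trace`). Now `Δf ≤ 0` at a maximum `a` and `Δf ≥ 0` at a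
minimum `b`, so `(nβ - 2α) R(a) ≤ 2nλ ≤ (nβ - 2α) R(b)`. Since `nβ > 2α`, this gives `R(a) ≤ R(b)`,
that is, `f(a) ≤ f(b)`: `f` is constant. Every point is then both a maximum and a minimum, so both
inequalities hold everywhere and `R = 2nλ / (nβ - 2α)`, which has the sign of `λ`. -/

open scoped Manifold ContDiff

noncomputable section

namespace RicciYamabe

/-! ### Second-order conditions at extrema, in coordinates. -/

section Coordinates

variable {n : ℕ} {u : EuclideanSpace ℝ (Fin n) → ℝ} {y : EuclideanSpace ℝ (Fin n)}

/-- The second derivative of a real function is nonpositive at a local maximum. -/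
lemma deriv_deriv_nonpos_of_isLocalMax {φ : ℝ → ℝ} {t : ℝ} (hc : ContinuousAt φ t)
    (h : IsLocalMax φ t) : deriv (deriv φ) t ≤ 0 := by
  by_contra! hpos
  -- A positive second derivative makes `t` a local minimum as well, so `φ` is constant near `t`.
  have hmin := isLocalMin_of_deriv_deriv_pos hpos h.deriv_eq_zero hc
  have hconst : φ =ᶠ[nhds t] fun _ => φ t := by
    filter_upwards [h, hmin] with s hs hs'
    exact le_antisymm hs hs'
  have : deriv (deriv φ) t = 0 := by
    rw [hconst.deriv.deriv_eq]
    simp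
  exact hpos.ne' this

/-- The second derivative along the line through `y` in the direction `v`. -/
lemma deriv_deriv_line (hu : ContDiffAt ℝ 2 u y) (v : EuclideanSpace ℝ (Fin n)) :
    deriv (deriv fun t : ℝ => u (y + t • v)) 0 =
      ∑ i, ∑ j, pderiv i (pderiv j u) y * v i * v j := by
  have hline (t : ℝ) : HasDerivAt (fun t : ℝ => y + t • v) v t := by
    simpa using ((hasDerivAt_id t).smul_const v).const_add y
  have hdiff : ∀ᶠ z in nhds y, DifferentiableAt ℝ u z :=
    (hu.eventually (by simp)).mono fun z hz => hz.differentiableAt (by simp)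
  have hfirst : deriv (fun t : ℝ => u (y + t • v)) =ᶠ[nhds 0]
      fun t => fderiv ℝ u (y + t • v) v := by
    have htend : Filter.Tendsto (fun t : ℝ => y + t • v) (nhds 0) (nhds y) := by
      simpa using (hline 0).continuousAt.tendsto
    filter_upwards [htend.eventually hdiff] with t ht
    exact (ht.hasFDerivAt.comp_hasDerivAt t (hline t)).deriv
  have hD : DifferentiableAt ℝ (fderiv ℝ u) y :=
    (hu.fderiv_right (m := 1) (by norm_num)).differentiableAt (by simp)
  have hE (w : EuclideanSpace ℝ (Fin n)) :
      HasFDerivAt (fun z => fderiv ℝ u z w) ((fderiv ℝ (fderiv ℝ u) y).flip w) y := by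
    have := hD.hasFDerivAt.clm_apply (hasFDerivAt_const w y)
    rwa [ContinuousLinearMap.comp_zero, zero_add] at this
  have hsecond : deriv (deriv fun t : ℝ => u (y + t • v)) 0 =
      fderiv ℝ (fderiv ℝ u) y v v := by
    rw [hfirst.deriv_eq]
    have hE0 : HasFDerivAt (fun z => fderiv ℝ u z v) ((fderiv ℝ (fderiv ℝ u) y).flip v)
        (y + (0 : ℝ) • v) := by
      rw [zero_smul, add_zero]
      exact hE v
    exact (hE0.comp_hasDerivAt (0 : ℝ) (hline 0)).deriv
  have hpd (i j : Fin n) : pderiv i (pderiv j u) y =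
      fderiv ℝ (fderiv ℝ u) y (EuclideanSpace.single i 1) (EuclideanSpace.single j 1) := by
    change fderiv ℝ (fun z => fderiv ℝ u z (EuclideanSpace.single j 1)) y _ = _
    rw [(hE _).fderiv, ContinuousLinearMap.flip_apply]
  have hv : v = ∑ i, v i • EuclideanSpace.single i (1 : ℝ) := by
    simpa using ((EuclideanSpace.basisFun (Fin n) ℝ).sum_repr v).symm
  rw [hsecond]
  conv_lhs => rw [hv]
  simp only [map_sum, map_smul, sum_apply, smul_apply,
    smul_eq_mul, hpd, Finset.mul_sum]
  rw [Finset.sum_comm]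
  refine Finset.sum_congr rfl fun i _ => Finset.sum_congr rfl fun j _ => ?_
  ring

/-- At a local maximum the matrix of second partial derivatives is negative semidefinite. -/
lemma sum_pderiv_pderiv_nonpos (hu : ContDiffAt ℝ 2 u y) (h : IsLocalMax u y)
    (v : EuclideanSpace ℝ (Fin n)) : ∑ i, ∑ j, pderiv i (pderiv j u) y * v i * v j ≤ 0 := by
  rw [← deriv_deriv_line hu v]
  have hline : Filter.Tendsto (fun t : ℝ => y + t • v) (nhds 0) (nhds (y + (0 : ℝ) • v)) :=
    Continuous.tendsto (by fun_prop) 0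
  have hy : y = y + (0 : ℝ) • v := by simp
  have hu' : ContinuousAt u (y + (0 : ℝ) • v) := hy ▸ hu.continuousAt
  have h' : IsLocalMax u (y + (0 : ℝ) • v) := hy ▸ h
  exact deriv_deriv_nonpos_of_isLocalMax (ContinuousAt.comp (g := u) hu' hline)
    (hline.eventually h')

lemma pderiv_neg (i : Fin n) (w : EuclideanSpace ℝ (Fin n) → ℝ) :
    pderiv i (-w) = -pderiv i w := by
  funext z
  simp [pderiv, fderiv_neg]

lemma hessianCoord_neg (G : EuclideanSpace ℝ (Fin n) → Matrix (Fin n) (Fin n) ℝ) (i j : Fin n) :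
    hessianCoord G (-u) i j y = -hessianCoord G u i j y := by
  simp only [hessianCoord, pderiv_neg, Pi.neg_apply, mul_neg, Finset.sum_neg_distrib]
  ring

/-- The Laplacian `g^ij ∇_i ∇_j u`. -/
def laplacianCoord (G : EuclideanSpace ℝ (Fin n) → Matrix (Fin n) (Fin n) ℝ)
    (u : EuclideanSpace ℝ (Fin n) → ℝ) (y : EuclideanSpace ℝ (Fin n)) : ℝ :=
  ∑ i, ∑ j, (G y)⁻¹ i j * hessianCoord G u i j y

/-- The Laplacian is nonpositive at a local maximum. -/
lemma laplacianCoord_nonpos {G : EuclideanSpace ℝ (Fin n) → Matrix (Fin n) (Fin n) ℝ}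
    (hG : (G y).PosDef) (hu : ContDiffAt ℝ 2 u y) (h : IsLocalMax u y) :
    laplacianCoord G u y ≤ 0 := by
  -- Writing `g⁻¹` as a sum of rank-one terms `b k (b k)ᵀ` turns the Laplacian at a critical point,
  -- where the Christoffel terms drop out, into a sum of second derivatives along the `b k`.
  obtain ⟨m, b, hb⟩ := Matrix.posSemidef_iff_eq_sum_vecMulVec.mp hG.inv.posSemidef
  have hgrad (k : Fin n) : pderiv k u y = 0 := by simp [pderiv, h.fderiv_eq_zero]
  have hsum : laplacianCoord G u y =
      ∑ k, ∑ i, ∑ j, pderiv i (pderiv j u) y * b k i * b k j := by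
    simp only [laplacianCoord, hessianCoord, hgrad, hb, Matrix.sum_apply, Matrix.vecMulVec_apply,
      star_trivial, mul_zero, Finset.sum_const_zero, sub_zero, Finset.sum_mul]
    conv_rhs =>
      rw [Finset.sum_comm]
      enter [2, i]
      rw [Finset.sum_comm]
    refine Finset.sum_congr rfl fun i _ => Finset.sum_congr rfl fun j _ =>
      Finset.sum_congr rfl fun k _ => ?_
    ring
  rw [hsum]
  exact Finset.sum_nonpos fun k _ => sum_pderiv_pderiv_nonpos hu h (WithLp.toLp 2 (b k))

/-- The Laplacian is nonnegative at a local minimum. -/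
lemma laplacianCoord_nonneg {G : EuclideanSpace ℝ (Fin n) → Matrix (Fin n) (Fin n) ℝ}
    (hG : (G y).PosDef) (hu : ContDiffAt ℝ 2 u y) (h : IsLocalMin u y) :
    0 ≤ laplacianCoord G u y := by
  have := laplacianCoord_nonpos hG hu.neg h.neg
  change laplacianCoord G (-u) y ≤ 0 at this
  simpa only [laplacianCoord, hessianCoord_neg, mul_neg, Finset.sum_neg_distrib,
    Left.neg_nonpos_iff] using this

end Coordinates

/-! ### The coordinate frame at a point and the traced soliton equation. -/

section Manifold

variable {n : ℕ} {M : Type*} [TopologicalSpace M] [ChartedSpace (EuclideanSpace ℝ (Fin n)) M]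

/-- The coordinate expression of `f` in the preferred chart at `p` is smooth at `p`. -/
lemma contDiffAt_comp_chartAt_symm [IsManifold (𝓡 n) ∞ M] {f : M → ℝ}
    (hf : ContMDiff (𝓡 n) 𝓘(ℝ) ∞ f) (p : M) :
    ContDiffAt ℝ ∞ (fun y => f ((chartAt (EuclideanSpace ℝ (Fin n)) p).symm y))
      (chartAt (EuclideanSpace ℝ (Fin n)) p p) := by
  have h1 := (contMDiffOn_chart_symm (I := 𝓡 n) (n := ∞) (x := p)).contMDiffAt
    ((chartAt (EuclideanSpace ℝ (Fin n)) p).open_target.mem_nhds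
      ((chartAt (EuclideanSpace ℝ (Fin n)) p).map_source (mem_chart_source _ p)))
  exact (hf.contMDiffAt.comp _ h1).contDiffAt

lemma differential_eq_fderiv {f : M → ℝ} {p : M} (hf : MDifferentiableAt (𝓡 n) 𝓘(ℝ) f p)
    (v : TangentSpace (𝓡 n) p) :
    differential f p v =
      fderiv ℝ (fun y => f ((chartAt (EuclideanSpace ℝ (Fin n)) p).symm y))
      (chartAt (EuclideanSpace ℝ (Fin n)) p p) v := by
  simp only [differential, mfderiv, hf]
  simp [writtenInExtChartAt, extChartAt, fderivWithin_univ, Function.comp_def]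
  rfl

variable [IsManifold (𝓡 n) ∞ M]

/-- The coordinate frame of the preferred chart at `p`, as tangent vectors at `p`. -/
def coordFrame (p : M) (i : Fin n) : TangentSpace (𝓡 n) p :=
  -- `coordVector` lies over `e.symm (e p)`, which equals `p` only propositionally; the vector is
  -- moved to `p` through the common model space.
  show EuclideanSpace ℝ (Fin n) from
    coordVector (chartAt (EuclideanSpace ℝ (Fin n)) p) i (chartAt (EuclideanSpace ℝ (Fin n)) p p)

lemma coordFrame_eq (p : M) (i : Fin n) :
    coordFrame p i = ((mdifferentiable_chart (I := 𝓡 n) p).mfderiv (mem_chart_source _ p)).symm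
      (show TangentSpace (𝓡 n) (chartAt (EuclideanSpace ℝ (Fin n)) p p) from
        (EuclideanSpace.single i 1 : EuclideanSpace ℝ (Fin n))) := rfl

lemma vectorCoord_coordFrame (p : M) (i j : Fin n) :
    vectorCoord (chartAt (EuclideanSpace ℝ (Fin n)) p) (coordFrame p i) j =
      if j = i then 1 else 0 := by
  have h := ((mdifferentiable_chart (I := 𝓡 n) p).mfderiv
    (mem_chart_source _ p)).apply_symm_apply
      (show TangentSpace (𝓡 n) (chartAt (EuclideanSpace ℝ (Fin n)) p p) from
        (EuclideanSpace.single i 1 : EuclideanSpace ℝ (Fin n)))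
  rw [← coordFrame_eq] at h
  have h' : mfderiv (𝓡 n) (𝓡 n) (chartAt (EuclideanSpace ℝ (Fin n)) p) p (coordFrame p i) =
    (EuclideanSpace.single i 1 : EuclideanSpace ℝ (Fin n)) := h
  simp only [vectorCoord, h']
  exact PiLp.single_apply ..

variable (g : Bundle.ContMDiffRiemannianMetric (𝓡 n) ∞ (EuclideanSpace ℝ (Fin n))
    (fun p : M => TangentSpace (𝓡 n) p))

/-- Replaces the base point `e.symm (e p)` by `p`; generalizing it to a variable `q` avoids
rewriting in dependent types. -/
lemma metricCoord_chartAt (p : M) (i j : Fin n) :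
    metricCoord g (chartAt (EuclideanSpace ℝ (Fin n)) p)
      (chartAt (EuclideanSpace ℝ (Fin n)) p p) i j =
      g.inner p (coordFrame p i) (coordFrame p j) := by
  have key (q : M) (h : q = p) (v w : EuclideanSpace ℝ (Fin n)) :
      g.inner q (show TangentSpace (𝓡 n) q from v) (show TangentSpace (𝓡 n) q from w) =
        g.inner p (show TangentSpace (𝓡 n) p from v) (show TangentSpace (𝓡 n) p from w) := by
    subst h
    rfl
  exact key _ ((chartAt (EuclideanSpace ℝ (Fin n)) p).left_inv (mem_chart_source _ p)) _ _

/-- The quadratic form at `x` is `g(X, X)` with `X = ∑ i, x i • ∂_i`, and `X ≠ 0` because the `dx^j`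
recover the coefficients of `X`. -/
lemma posDef_metricCoord_chartAt (p : M) :
    (metricCoord g (chartAt (EuclideanSpace ℝ (Fin n)) p)
      (chartAt (EuclideanSpace ℝ (Fin n)) p p)).PosDef := by
  refine Matrix.PosDef.of_dotProduct_mulVec_pos ?_ fun x hx => ?_
  · ext i j
    simp [metricCoord_chartAt, g.symm p (coordFrame p i)]
  · have hne : ∑ i, x i • coordFrame p i ≠ 0 := by
      intro h0
      apply hx
      funext j
      have h1 : vectorCoord (chartAt (EuclideanSpace ℝ (Fin n)) p) (∑ i, x i • coordFrame p i) j =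
          ∑ i, x i * vectorCoord (chartAt (EuclideanSpace ℝ (Fin n)) p) (coordFrame p i) j := by
        simp only [vectorCoord, map_sum, map_smul]
        exact map_sum (EuclideanSpace.proj j : EuclideanSpace ℝ (Fin n) →L[ℝ] ℝ) _ _
      rw [h0] at h1
      have h2 : vectorCoord (chartAt (EuclideanSpace ℝ (Fin n)) p)
          (0 : TangentSpace (𝓡 n) p) j = 0 := by
        simp only [vectorCoord, map_zero]
        rfl
      simpa [h2, vectorCoord_coordFrame] using h1.symm
    refine (g.pos p _ hne).trans_eq ?_
    simp only [map_sum, map_smul, sum_apply, smul_apply,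
      smul_eq_mul, dotProduct, Matrix.mulVec, Pi.star_apply, star_trivial, metricCoord_chartAt,
      Finset.mul_sum]
    rw [Finset.sum_comm]
    refine Finset.sum_congr rfl fun i _ => Finset.sum_congr rfl fun j _ => ?_
    ring

/-- This is the trace of `G⁻¹ G = 1`, up to the symmetry of `g`. -/
lemma sum_inv_mul_metricCoord (p : M) :
    ∑ i, ∑ j, (metricCoord g (chartAt (EuclideanSpace ℝ (Fin n)) p)
      (chartAt (EuclideanSpace ℝ (Fin n)) p p))⁻¹ i j *
        g.inner p (coordFrame p i) (coordFrame p j) = n := by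
  have h := congrArg Matrix.trace (Matrix.nonsing_inv_mul _
    ((Matrix.isUnit_iff_isUnit_det _).mp (posDef_metricCoord_chartAt g p).isUnit))
  simp only [Matrix.trace, Matrix.diag_apply, Matrix.mul_apply, metricCoord_chartAt,
    Matrix.one_apply_eq, Finset.sum_const, Finset.card_univ, Fintype.card_fin, nsmul_eq_mul,
    mul_one] at h
  rw [← h]
  refine Finset.sum_congr rfl fun i _ => Finset.sum_congr rfl fun j _ => ?_
  rw [g.symm]

lemma ricci_coordFrame (p : M) (i j : Fin n) :
    ricci g p (coordFrame p i) (coordFrame p j) =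
      ricciCoord (metricCoord g (chartAt (EuclideanSpace ℝ (Fin n)) p)) i j
        (chartAt (EuclideanSpace ℝ (Fin n)) p p) := by
  simp [ricci, vectorCoord_coordFrame]

lemma hessian_coordFrame (f : M → ℝ) (p : M) (i j : Fin n) :
    hessian g f p (coordFrame p i) (coordFrame p j) =
      hessianCoord (metricCoord g (chartAt (EuclideanSpace ℝ (Fin n)) p))
        (fun y => f ((chartAt (EuclideanSpace ℝ (Fin n)) p).symm y)) i j
        (chartAt (EuclideanSpace ℝ (Fin n)) p p) := by
  simp [hessian, vectorCoord_coordFrame]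

variable {g}

/-- The trace of the soliton equation at a critical point of the potential. -/
lemma IsGeneralizedGradientRicciYamabeSoliton.trace {f : M → ℝ} {α β lam μ : ℝ}
    (h : IsGeneralizedGradientRicciYamabeSoliton g f α β lam μ) {p : M}
    (hp : ∀ v : TangentSpace (𝓡 n) p, differential f p v = 0) :
    α * scalarCurvature g p +
      laplacianCoord (metricCoord g (chartAt (EuclideanSpace ℝ (Fin n)) p))
        (fun y => f ((chartAt (EuclideanSpace ℝ (Fin n)) p).symm y))
        (chartAt (EuclideanSpace ℝ (Fin n)) p p) +
      (lam - β / 2 * scalarCurvature g p) * n = 0 := by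
  rw [← sum_inv_mul_metricCoord g p]
  -- Only the Ricci trace is expanded; the `R` multiplying the metric stays a scalar factor.
  conv_lhs => enter [1, 1]; rw [scalarCurvature]
  simp only [scalarCoord, laplacianCoord, Finset.mul_sum, ← Finset.sum_add_distrib]
  refine Finset.sum_eq_zero fun i _ => Finset.sum_eq_zero fun j _ => ?_
  have := h.equation p (coordFrame p i) (coordFrame p j)
  rw [ricci_coordFrame, hessian_coordFrame, hp, hp] at this
  linear_combination (metricCoord g (chartAt (EuclideanSpace ℝ (Fin n)) p)
      (chartAt (EuclideanSpace ℝ (Fin n)) p p))⁻¹ i j * this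

lemma IsGeneralizedGradientRicciYamabeSoliton.differential_eq_zero {f : M → ℝ} {α β lam μ : ℝ}
    (h : IsGeneralizedGradientRicciYamabeSoliton g f α β lam μ) {p : M}
    (hp : IsExtrOn f Set.univ p) (v : TangentSpace (𝓡 n) p) : differential f p v = 0 := by
  rw [differential_eq_fderiv (h.smooth.mdifferentiableAt (by simp))]
  have : IsLocalExtr (fun y => f ((chartAt (EuclideanSpace ℝ (Fin n)) p).symm y))
      (chartAt (EuclideanSpace ℝ (Fin n)) p p) := by
    have hinv := (chartAt (EuclideanSpace ℝ (Fin n)) p).left_inv (mem_chart_source _ p)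
    refine hp.imp (fun hp => ?_) fun hp => ?_ <;>
    -- The extremum is global and `e.symm` is total, so the inequality holds for every `y`, even
    -- outside the chart's target.
    · refine Filter.Eventually.of_forall fun y => ?_
      simpa only [hinv, Set.mem_ofPred_eq] using hp (Set.mem_univ ((chartAt (EuclideanSpace ℝ (Fin n)) p).symm y))
  rw [this.fderiv_eq_zero]
  rfl

/-- At a maximum of the potential, `(n β - 2 α) R ≤ 2 n lam`. -/
lemma IsGeneralizedGradientRicciYamabeSoliton.le_of_isMaxOn {f : M → ℝ} {α β lam μ : ℝ}
    (h : IsGeneralizedGradientRicciYamabeSoliton g f α β lam μ) {p : M}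
    (hp : IsMaxOn f Set.univ p) : (n * β - 2 * α) * scalarCurvature g p ≤ 2 * n * lam := by
  have hmax : IsLocalMax (fun y => f ((chartAt (EuclideanSpace ℝ (Fin n)) p).symm y))
      (chartAt (EuclideanSpace ℝ (Fin n)) p p) := by
    refine Filter.Eventually.of_forall fun y => ?_
    simpa only [(chartAt (EuclideanSpace ℝ (Fin n)) p).left_inv (mem_chart_source _ p),
      Set.mem_ofPred_eq] using hp (Set.mem_univ ((chartAt (EuclideanSpace ℝ (Fin n)) p).symm y))
  have hlap := laplacianCoord_nonpos (posDef_metricCoord_chartAt g p)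
    (contDiffAt_infty.mp (contDiffAt_comp_chartAt_symm h.smooth p) 2) hmax
  linarith [h.trace (h.differential_eq_zero (Or.inr hp))]

/-- At a minimum of the potential, `2 n lam ≤ (n β - 2 α) R`. -/
lemma IsGeneralizedGradientRicciYamabeSoliton.ge_of_isMinOn {f : M → ℝ} {α β lam μ : ℝ}
    (h : IsGeneralizedGradientRicciYamabeSoliton g f α β lam μ) {p : M}
    (hp : IsMinOn f Set.univ p) : 2 * n * lam ≤ (n * β - 2 * α) * scalarCurvature g p := by
  have hmin : IsLocalMin (fun y => f ((chartAt (EuclideanSpace ℝ (Fin n)) p).symm y))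
      (chartAt (EuclideanSpace ℝ (Fin n)) p p) := by
    refine Filter.Eventually.of_forall fun y => ?_
    simpa only [(chartAt (EuclideanSpace ℝ (Fin n)) p).left_inv (mem_chart_source _ p),
      Set.mem_ofPred_eq] using hp (Set.mem_univ ((chartAt (EuclideanSpace ℝ (Fin n)) p).symm y))
  have hlap := laplacianCoord_nonneg (posDef_metricCoord_chartAt g p)
    (contDiffAt_infty.mp (contDiffAt_comp_chartAt_symm h.smooth p) 2) hmin
  linarith [h.trace (h.differential_eq_zero (Or.inl hp))]

/-- If `R = f` at the extrema of the potential of a compact soliton and `n β > 2 α`, then the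
scalar curvature is the constant `2 n lam / (n β - 2 α)`. -/
lemma IsGeneralizedGradientRicciYamabeSoliton.scalarCurvature_const [CompactSpace M]
    {f : M → ℝ} {α β lam μ : ℝ}
    (h : IsGeneralizedGradientRicciYamabeSoliton g f α β lam μ)
    (hextr : ∀ p : M, IsExtrOn f Set.univ p → scalarCurvature g p = f p)
    (hαβ : 2 * α < n * β) (p : M) :
    (n * β - 2 * α) * scalarCurvature g p = 2 * n * lam := by
  have hc : 0 < n * β - 2 * α := sub_pos.mpr hαβ
  have hcont : ContinuousOn f Set.univ := h.smooth.continuous.continuousOn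
  obtain ⟨a, -, ha⟩ := isCompact_univ.exists_isMaxOn ⟨p, Set.mem_univ p⟩ hcont
  obtain ⟨b, -, hb⟩ := isCompact_univ.exists_isMinOn ⟨p, Set.mem_univ p⟩ hcont
  have hab : f a ≤ f b := by
    rw [← hextr a (Or.inr ha), ← hextr b (Or.inl hb)]
    exact le_of_mul_le_mul_left ((h.le_of_isMaxOn ha).trans (h.ge_of_isMinOn hb)) hc
  -- Any value of `f` lies between `f b` and `f a`, and `f a ≤ f b`, so all values coincide.
  have hmax : IsMaxOn f Set.univ p := fun x _ =>
    (ha (Set.mem_univ x)).trans (hab.trans (hb (Set.mem_univ p)))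
  have hmin : IsMinOn f Set.univ p := fun x _ =>
    (ha (Set.mem_univ p)).trans (hab.trans (hb (Set.mem_univ x)))
  exact le_antisymm (h.le_of_isMaxOn hmax) (h.ge_of_isMinOn hmin)

end Manifold

end RicciYamabe

end

open RicciYamabe in
/-- On a compact generalized gradient Ricci-Yamabe soliton with `R = f` wherever `f` attains its
maximum or minimum, and `n β > 2 α`, the sign of the scalar curvature is determined by the type of
the soliton. -/
theorem mainTheorem10 {n : ℕ} (hn : 1 ≤ n) {M : Type*} [TopologicalSpace M] [T2Space M]
    [CompactSpace M] [ChartedSpace (EuclideanSpace ℝ (Fin n)) M] [IsManifold (𝓡 n) ∞ M]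
    (g : Bundle.ContMDiffRiemannianMetric (𝓡 n) ∞ (EuclideanSpace ℝ (Fin n))
      (fun p : M => TangentSpace (𝓡 n) p))
    (f : M → ℝ) (α β lam μ : ℝ)
    (hsol : IsGeneralizedGradientRicciYamabeSoliton g f α β lam μ)
    (hextr : ∀ p : M, IsExtrOn f Set.univ p → scalarCurvature g p = f p)
    (hαβ : 2 * α < n * β) :
    ∀ p : M, (IsShrinking lam ↔ scalarCurvature g p < 0) ∧
      (IsSteady lam ↔ scalarCurvature g p = 0) ∧
      (IsExpanding lam ↔ 0 < scalarCurvature g p) := by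
  intro p
  have hc : 0 < n * β - 2 * α := sub_pos.mpr hαβ
  -- Here `n ≥ 1` enters: it makes the factor between `R` and `λ` nonzero.
  have hn' : (0 : ℝ) < 2 * n := by positivity
  have hR : scalarCurvature g p = 2 * n / (n * β - 2 * α) * lam := by
    rw [div_mul_eq_mul_div, eq_div_iff hc.ne', mul_comm]
    exact hsol.scalarCurvature_const hextr hαβ p
  have hk : 0 < 2 * n / (n * β - 2 * α) := div_pos hn' hc
  simp only [IsShrinking, IsSteady, IsExpanding, hR]
  refine ⟨?_, ?_, ?_⟩
  · rw [← neg_pos, ← neg_pos (a := _ * lam), ← mul_neg, mul_pos_iff_of_pos_left hk]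
  · rw [mul_eq_zero, or_iff_right hk.ne']
  · rw [mul_pos_iff_of_pos_left hk]
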